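/- Let $n\ge 0$ and let $\theta=(\theta_{ij})\in M_n(\mathbb R)$ be skew-symmetric; put $\omega_{ij}=e^{2\pi\mathrm{i}\theta_{ij}}$. Let $A_u$ be the universal unital C*-algebra generated by elements $u_{ik}$, $i,k=1,\dots,n$, subject to the relations (for all $i,j,k,l\in\{1,\dots,n\}$) $$u_{ik}u_{jl}+\omega_{ji}u_{jk}u_{il}=\omega_{kl}u_{il}u_{jk}+\omega_{ji}\omega_{kl}u_{jl}u_{ik},$$ $$\sum_{i=1}^n u_{ik}u_{il}^*=\delta_{kl}1,\qquad \sum_{i=1}^n u_{il}^*u_{ik}=\delta_{kl}1,$$ $$u_{jk}u_{ik}^*=0\quad\text{and}\quad u_{ik}^*u_{jk}=0\qquad (i\ne j).$$ For a real skew-symmetric matrix $\eta=(\eta_{ij})\in M_n(\mathbb R)$, let $C(\mathbb T^n_\eta)$ (the noncommutative $n$-torus) be the universal unital C*-algebra generated by unitaries $x_1,\dots,x_n$ with $x_ix_j=e^{2\pi\mathrm{i}\eta_{ij}}x_jx_i$ for all $i,j$. For $\sigma\in S_n$ let $\theta^{(\sigma)}$ be the skew-symmetric matrix $\theta^{(\sigma)}_{ij}=\theta_{ji}+\theta_{\sigma^{-1}(i),\sigma^{-1}(j)}$,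 put $$A^n_\theta=\bigoplus_{\sigma\in S_n}C\bigl(\mathbb T^n_{\theta^{(\sigma)}}\bigr),$$ and let $x_{\sigma,i}\in A^n_\theta$ be the $i$-th generator of the summand with index $\sigma$ (and $0$ in the other summands). Then $A_u$ and $A^n_\theta$ are isomorphic C*-algebras; more precisely, there is a $*$-isomorphism $\Phi:A_u\to A^n_\theta$ with $$\Phi(u_{ik})=\sum_{\sigma\in S_n,\ \sigma(k)=i}x_{\sigma,i}\qquad(i,k=1,\dots,n).$$ -/

import Mathlib

noncomputable section

namespace QMultitorus

universe u v

/-! ### The free unital star-algebra on a set of generators -/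

/-- The free unital complex `*`-algebra on the set `G`: noncommutative polynomials in the letters
`x_g` (the letter `Sum.inl g`) and `x_g^*` (the letter `Sum.inr g`). -/
abbrev FreeStarAlg (G : Type u) : Type u := MonoidAlgebra ℂ (FreeMonoid (G ⊕ G))

namespace FreeStarAlg

variable {G : Type u}

/-- A single letter, as a noncommutative polynomial. -/
def letter (x : G ⊕ G) : FreeStarAlg G := MonoidAlgebra.single (FreeMonoid.of x) 1

/-- The generator `x_g`. -/
def X (g : G) : FreeStarAlg G := letter (Sum.inl g)

/-- The involution as a ring homomorphism into the opposite ring: it conjugates scalars, exchanges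
`x_g` with `x_g^*`, and reverses products. -/
def starHom : FreeStarAlg G →+* (FreeStarAlg G)ᵐᵒᵖ :=
  MonoidAlgebra.liftNCRingHom
    (((algebraMap ℂ (FreeStarAlg G)ᵐᵒᵖ)).comp (starRingEnd ℂ))
    (FreeMonoid.lift fun x => MulOpposite.op (letter x.swap))
    (by intro c w; exact Algebra.commute_algebraMap_left (starRingEnd ℂ c) _)

theorem starHom_letter (x : G ⊕ G) : starHom (letter x) = MulOpposite.op (letter x.swap) := by
  simp only [starHom, letter, MonoidAlgebra.liftNCRingHom_single, map_one, one_mul,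
    FreeMonoid.lift_eval_of]

theorem starHom_algebraMap (c : ℂ) :
    starHom (algebraMap ℂ (FreeStarAlg G) c) =
      MulOpposite.op (algebraMap ℂ (FreeStarAlg G) (starRingEnd ℂ c)) := by
  change MonoidAlgebra.liftNCRingHom _ _ _ (MonoidAlgebra.single 1 c) = _
  rw [MonoidAlgebra.liftNCRingHom_single, map_one, mul_one]
  rfl

/-- Induction on noncommutative polynomials. -/
theorem induct {p : FreeStarAlg G → Prop} (hc : ∀ c, p (algebraMap ℂ _ c))
    (hl : ∀ x, p (letter x)) (hadd : ∀ a b, p a → p b → p (a + b))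
    (hmul : ∀ a b, p a → p b → p (a * b)) (a : FreeStarAlg G) : p a := by
  have hw : ∀ w : FreeMonoid (G ⊕ G), p (MonoidAlgebra.single w 1) := by
    intro w
    induction w using FreeMonoid.inductionOn' with
    | one => simpa [MonoidAlgebra.one_def] using hc 1
    | of_mul x w ih => simpa [letter, MonoidAlgebra.single_mul_single] using hmul _ _ (hl x) ih
  induction a using MonoidAlgebra.induction_linear with
  | zero => simpa using hc 0
  | add f g hf hg => exact hadd _ _ hf hg
  | single w c =>
    have := hmul _ _ (hc c) (hw w)
    simpa [MonoidAlgebra.single_mul_single] using this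

instance : Star (FreeStarAlg G) := ⟨fun a => (starHom a).unop⟩

theorem star_def (a : FreeStarAlg G) : star a = (starHom a).unop := rfl

instance : StarRing (FreeStarAlg G) where
  star_involutive a := by
    induction a using induct with
    | hc c => simp only [star_def, starHom_algebraMap, MulOpposite.unop_op, Complex.conj_conj]
    | hl x => simp only [star_def, starHom_letter, MulOpposite.unop_op, Sum.swap_swap]
    | hadd a b ha hb =>
      simp only [star_def, map_add, MulOpposite.unop_add] at ha hb ⊢
      rw [ha, hb]
    | hmul a b ha hb =>
      simp only [star_def, map_mul, MulOpposite.unop_mul] at ha hb ⊢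
      rw [ha, hb]
  star_mul a b := by simp [star_def]
  star_add a b := by simp [star_def]

theorem star_letter (x : G ⊕ G) : star (letter x) = letter x.swap := by
  simp [star_def, starHom_letter]

theorem star_X (g : G) : star (X g) = letter (Sum.inr g) := star_letter _

theorem star_algebraMap' (c : ℂ) :
    star (algebraMap ℂ (FreeStarAlg G) c) = algebraMap ℂ _ (starRingEnd ℂ c) := by
  rw [star_def, starHom_algebraMap, MulOpposite.unop_op]

instance : StarModule ℂ (FreeStarAlg G) where
  star_smul c a := by
    rw [Algebra.smul_def, star_mul, star_algebraMap', Algebra.smul_def, Algebra.commutes]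
    rfl

/-- Evaluation of noncommutative `*`-polynomials at a family of elements of a `*`-algebra. -/
def eval {B : Type v} [Ring B] [StarRing B] [Algebra ℂ B] [StarModule ℂ B] (f : G → B) :
    FreeStarAlg G →⋆ₐ[ℂ] B where
  __ := MonoidAlgebra.lift ℂ B (FreeMonoid (G ⊕ G))
    (FreeMonoid.lift (Sum.elim f fun g => star (f g)))
  map_star' a := by
    change MonoidAlgebra.lift ℂ B (FreeMonoid (G ⊕ G)) _ _ =
      star (MonoidAlgebra.lift ℂ B (FreeMonoid (G ⊕ G)) _ _)
    induction a using induct with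
    | hc c =>
      rw [star_algebraMap', AlgHom.commutes, AlgHom.commutes, ← algebraMap_star_comm]
      rfl
    | hl x => rw [star_letter]; cases x <;> simp [letter]
    | hadd a b ha hb => simp only [star_add, map_add, ha, hb]
    | hmul a b ha hb => simp only [star_mul, map_mul, ha, hb]

theorem eval_X {B : Type v} [Ring B] [StarRing B] [Algebra ℂ B] [StarModule ℂ B] (f : G → B)
    (g : G) : eval f (X g) = f g := by
  change MonoidAlgebra.lift ℂ B (FreeMonoid (G ⊕ G)) _ _ = _
  simp [X, letter]

end FreeStarAlg

/-! ### Universal C*-algebras given by generators and relations -/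

section Universal

variable {G : Type u} (rel : FreeStarAlg G → FreeStarAlg G → Prop)

/-- A C*-seminorm on the free `*`-algebra that annihilates the relations `a = b` (for `rel a b`).
By separation and completion these are the seminorms `a ↦ ‖π a‖`, where `π` runs through
the representations of the relations in C*-algebras. -/
structure RelSeminorm extends Seminorm ℂ (FreeStarAlg G) where
  mul_le' : ∀ a b, toFun (a * b) ≤ toFun a * toFun b
  star_mul_self' : ∀ a, toFun (star a * a) = toFun a * toFun a
  rel' : ∀ a b, rel a b → toFun (a - b) = 0

variable {rel}

namespace RelSeminorm

instance : CoeFun (RelSeminorm rel) (fun _ => FreeStarAlg G → ℝ) := ⟨fun p => p.toSeminorm⟩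

variable (p : RelSeminorm rel)

theorem nonneg (a : FreeStarAlg G) : 0 ≤ p a := apply_nonneg p.toSeminorm a

theorem mul_le (a b : FreeStarAlg G) : p (a * b) ≤ p a * p b := p.mul_le' a b

theorem star_mul_self (a : FreeStarAlg G) : p (star a * a) = p a * p a := p.star_mul_self' a

theorem star_eq (a : FreeStarAlg G) : p (star a) = p a := by
  have key : ∀ b, p b ≤ p (star b) := by
    intro b
    by_contra! h
    have h1 := p.mul_le (star b) b
    rw [p.star_mul_self] at h1
    nlinarith [p.nonneg b, p.nonneg (star b)]
  exact le_antisymm (by simpa using key (star a)) (key a)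

theorem one_le : p 1 ≤ 1 := by
  have h := p.star_mul_self 1
  rw [star_one, mul_one] at h
  nlinarith [p.nonneg 1]

theorem congr_rel {a b : FreeStarAlg G} (h : rel a b) : p a = p b := by
  have h0 : p (a - b) = 0 := p.rel' a b h
  have h1 := map_sub_le_add p.toSeminorm a (a - b)
  have h2 := map_add_le_add p.toSeminorm (a - b) b
  have h3 : p (a - (a - b)) ≤ p a + p (a - b) := h1
  have h4 : p (a - b + b) ≤ p (a - b) + p b := h2
  rw [sub_sub_cancel] at h3
  rw [sub_add_cancel] at h4
  linarith

end RelSeminorm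

/-- The seminorm of a representation of the relations in a C*-algebra. -/
def RelSeminorm.ofRep {B : Type v} [CStarAlgebra B] (f : G → B)
    (hf : ∀ a b, rel a b → FreeStarAlg.eval f a = FreeStarAlg.eval f b) : RelSeminorm rel where
  __ := (normSeminorm ℂ B).comp (FreeStarAlg.eval f).toAlgHom.toLinearMap
  mul_le' a b := by
    change ‖FreeStarAlg.eval f (a * b)‖ ≤ ‖FreeStarAlg.eval f a‖ * ‖FreeStarAlg.eval f b‖
    rw [map_mul]; exact norm_mul_le _ _
  star_mul_self' a := by
    change ‖FreeStarAlg.eval f (star a * a)‖ = ‖FreeStarAlg.eval f a‖ * ‖FreeStarAlg.eval f a‖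
    rw [map_mul, map_star]; exact CStarRing.norm_star_mul_self
  rel' a b h := by
    change ‖FreeStarAlg.eval f (a - b)‖ = 0
    rw [map_sub, hf a b h, sub_self, norm_zero]

theorem RelSeminorm.ofRep_apply {B : Type v} [CStarAlgebra B] (f : G → B)
    (hf : ∀ a b, rel a b → FreeStarAlg.eval f a = FreeStarAlg.eval f b) (a : FreeStarAlg G) :
    RelSeminorm.ofRep f hf a = ‖FreeStarAlg.eval f a‖ := rfl

instance : Nonempty (RelSeminorm rel) :=
  ⟨{ (0 : Seminorm ℂ (FreeStarAlg G)) with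
      mul_le' := fun _ _ => (zero_mul (0 : ℝ)).ge
      star_mul_self' := fun _ => (zero_mul (0 : ℝ)).symm
      rel' := fun _ _ _ => rfl }⟩

variable (rel)

/-- Relations are admissible if every generator is uniformly bounded over all representations. -/
class Admissible : Prop where
  bdd : ∀ g : G, ∃ C : ℝ, ∀ p : RelSeminorm rel, p (FreeStarAlg.X g) ≤ C

/-- The universal C*-seminorm: the supremum over all representations of the relations. -/
def univSeminorm (a : FreeStarAlg G) : ℝ := ⨆ p : RelSeminorm rel, p a

theorem bddAbove_univSeminorm [h : Admissible rel] (a : FreeStarAlg G) :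
    BddAbove (Set.range fun p : RelSeminorm rel => p a) := by
  suffices ∃ C : ℝ, ∀ p : RelSeminorm rel, p a ≤ C by
    obtain ⟨C, hC⟩ := this
    exact ⟨C, by rintro _ ⟨p, rfl⟩; exact hC p⟩
  induction a using FreeStarAlg.induct with
  | hc c =>
    refine ⟨‖c‖, fun p => ?_⟩
    rw [Algebra.algebraMap_eq_smul_one]
    have h1 : p (c • (1 : FreeStarAlg G)) = ‖c‖ * p 1 := map_smul_eq_mul p.toSeminorm c 1
    rw [h1]
    exact mul_le_of_le_one_right (norm_nonneg c) p.one_le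
  | hl x =>
    cases x with
    | inl g => exact h.bdd g
    | inr g =>
      obtain ⟨C, hC⟩ := h.bdd g
      refine ⟨C, fun p => ?_⟩
      rw [← FreeStarAlg.star_X, p.star_eq]
      exact hC p
  | hadd a b ha hb =>
    obtain ⟨C, hC⟩ := ha
    obtain ⟨D, hD⟩ := hb
    exact ⟨C + D, fun p => (map_add_le_add p.toSeminorm a b).trans (add_le_add (hC p) (hD p))⟩
  | hmul a b ha hb =>
    obtain ⟨C, hC⟩ := ha
    obtain ⟨D, hD⟩ := hb
    refine ⟨C * D, fun p => (p.mul_le a b).trans ?_⟩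
    exact mul_le_mul (hC p) (hD p) (p.nonneg b) ((p.nonneg a).trans (hC p))

theorem RelSeminorm.le_univ {rel} [Admissible rel] (p : RelSeminorm rel) (a : FreeStarAlg G) :
    p a ≤ univSeminorm rel a :=
  le_ciSup (bddAbove_univSeminorm rel a) p

theorem univSeminorm_nonneg [Admissible rel] (a : FreeStarAlg G) : 0 ≤ univSeminorm rel a :=
  ((Classical.arbitrary (RelSeminorm rel)).nonneg a).trans (RelSeminorm.le_univ _ a)

/-- The universal C*-seminorm is itself a C*-seminorm that annihilates the relations. -/
def univRelSeminorm [Admissible rel] : RelSeminorm rel where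
  toFun := univSeminorm rel
  map_zero' := by
    have : ∀ p : RelSeminorm rel, p 0 = 0 := fun p => map_zero p.toSeminorm
    simp [univSeminorm, this]
  add_le' a b := ciSup_le fun p => (map_add_le_add p.toSeminorm a b).trans
    (add_le_add (p.le_univ a) (p.le_univ b))
  neg' a := by
    have : ∀ p : RelSeminorm rel, p (-a) = p a := fun p => map_neg_eq_map p.toSeminorm a
    simp [univSeminorm, this]
  smul' c a := by
    have : ∀ p : RelSeminorm rel, p (c • a) = ‖c‖ * p a :=
      fun p => map_smul_eq_mul p.toSeminorm c a
    simp only [univSeminorm, this]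
    exact (Real.mul_iSup_of_nonneg (norm_nonneg c) _).symm
  mul_le' a b := ciSup_le fun p => (p.mul_le a b).trans
    (mul_le_mul (p.le_univ a) (p.le_univ b) (p.nonneg b) (univSeminorm_nonneg rel a))
  star_mul_self' a := by
    apply le_antisymm
    · refine ciSup_le fun p => ?_
      rw [p.star_mul_self]
      exact mul_le_mul (p.le_univ a) (p.le_univ a) (p.nonneg a) (univSeminorm_nonneg rel a)
    · have h0 := univSeminorm_nonneg rel (star a * a)
      have h1 : univSeminorm rel a ≤ Real.sqrt (univSeminorm rel (star a * a)) := by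
        refine ciSup_le fun p => Real.le_sqrt_of_sq_le ?_
        rw [sq, ← p.star_mul_self]
        exact p.le_univ _
      calc univSeminorm rel a * univSeminorm rel a
          ≤ Real.sqrt (univSeminorm rel (star a * a)) * Real.sqrt (univSeminorm rel (star a * a)) :=
            mul_self_le_mul_self (univSeminorm_nonneg rel a) h1
        _ = _ := Real.mul_self_sqrt h0
  rel' a b h := by
    have : ∀ p : RelSeminorm rel, p (a - b) = 0 := fun p => p.rel' a b h
    simp [univSeminorm, this]

theorem univRelSeminorm_apply [Admissible rel] (a : FreeStarAlg G) :
    univRelSeminorm rel a = univSeminorm rel a := rfl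

/-- The free `*`-algebra, to be endowed with the universal C*-seminorm. -/
def PreUniv (_rel : FreeStarAlg G → FreeStarAlg G → Prop) : Type u := FreeStarAlg G

namespace PreUniv

instance : Ring (PreUniv rel) := inferInstanceAs (Ring (FreeStarAlg G))
instance : StarRing (PreUniv rel) := inferInstanceAs (StarRing (FreeStarAlg G))
instance : Algebra ℂ (PreUniv rel) := inferInstanceAs (Algebra ℂ (FreeStarAlg G))
instance : StarModule ℂ (PreUniv rel) := inferInstanceAs (StarModule ℂ (FreeStarAlg G))

variable [Admissible rel]

instance : SeminormedRing (PreUniv rel) :=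
  RingSeminorm.toSeminormedRing (R := PreUniv rel)
    { toFun := univSeminorm rel
      map_zero' := (univRelSeminorm rel).map_zero'
      add_le' := (univRelSeminorm rel).add_le'
      neg' := (univRelSeminorm rel).neg'
      mul_le' := (univRelSeminorm rel).mul_le' }

theorem norm_def (a : PreUniv rel) : ‖a‖ = univSeminorm rel a := rfl

instance : NormedAlgebra ℂ (PreUniv rel) where
  norm_smul_le c a := ((univRelSeminorm rel).smul' c a).le

theorem norm_star' (a : PreUniv rel) : ‖star a‖ = ‖a‖ := (univRelSeminorm rel).star_eq a

theorem norm_star_mul_self' (a : PreUniv rel) : ‖star a * a‖ = ‖a‖ * ‖a‖ :=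
  (univRelSeminorm rel).star_mul_self a

theorem uniformContinuous_star : UniformContinuous (star : PreUniv rel → PreUniv rel) := by
  refine (Isometry.of_dist_eq fun a b => ?_).uniformContinuous
  rw [dist_eq_norm, dist_eq_norm, ← star_sub, norm_star']

end PreUniv

/-- The universal unital C*-algebra with generating set `G` and relations `rel`: the separation and
completion of the free `*`-algebra with respect to the universal C*-seminorm. -/
def UnivCStar [Admissible rel] : Type u := UniformSpace.Completion (PreUniv rel)

namespace UnivCStar

open UniformSpace

variable [Admissible rel]

instance : NormedRing (UnivCStar rel) := inferInstanceAs (NormedRing (Completion (PreUniv rel)))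
instance : CompleteSpace (UnivCStar rel) :=
  inferInstanceAs (CompleteSpace (Completion (PreUniv rel)))
instance : Algebra ℂ (UnivCStar rel) := inferInstanceAs (Algebra ℂ (Completion (PreUniv rel)))
instance : NormedAlgebra ℂ (UnivCStar rel) where
  norm_smul_le c a := norm_smul_le (β := Completion (PreUniv rel)) c a

/-- The canonical map from the free `*`-algebra. -/
def mk (a : FreeStarAlg G) : UnivCStar rel := Completion.coe' (α := PreUniv rel) a

variable {rel}

theorem induct {p : UnivCStar rel → Prop} (hp : IsClosed {x | p x}) (h : ∀ a, p (mk rel a))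
    (x : UnivCStar rel) : p x :=
  Completion.induction_on (α := PreUniv rel) x hp h

theorem mk_add (a b : FreeStarAlg G) : mk rel (a + b) = mk rel a + mk rel b :=
  Completion.coe_add (α := PreUniv rel) a b
theorem mk_mul (a b : FreeStarAlg G) : mk rel (a * b) = mk rel a * mk rel b :=
  Completion.coe_mul (α := PreUniv rel) a b
theorem mk_algebraMap (c : ℂ) : mk rel (algebraMap ℂ _ c) = algebraMap ℂ _ c := rfl
theorem norm_mk (a : FreeStarAlg G) : ‖mk rel a‖ = univSeminorm rel a :=
  Completion.norm_coe (E := PreUniv rel) a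

instance : Star (UnivCStar rel) := ⟨Completion.map (star : PreUniv rel → PreUniv rel)⟩

theorem continuous_star' : Continuous (star : UnivCStar rel → UnivCStar rel) :=
  Completion.continuous_map (α := PreUniv rel)

theorem mk_star (a : FreeStarAlg G) : mk rel (star a) = star (mk rel a) :=
  (Completion.map_coe (PreUniv.uniformContinuous_star rel) a).symm

instance : StarRing (UnivCStar rel) where
  star_involutive x := by
    induction x using induct with
    | hp =>
    exact isClosed_eq (continuous_star'.comp continuous_star') continuous_id
      | h a => rw [← mk_star, ← mk_star, star_star]
  star_mul x y := by
    induction x using induct with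
    | hp =>
        exact isClosed_eq (continuous_star'.comp (continuous_id.mul continuous_const))
          (continuous_const.mul continuous_star')
    | h a =>
      induction y using induct with
      | hp =>
          exact isClosed_eq (continuous_star'.comp (continuous_const.mul continuous_id))
            (continuous_star'.mul continuous_const)
      | h b => rw [← mk_mul, ← mk_star, ← mk_star, ← mk_star, star_mul, mk_mul]
  star_add x y := by
    induction x using induct with
    | hp =>
        exact isClosed_eq (continuous_star'.comp (continuous_id.add continuous_const))
          (continuous_star'.add continuous_const)
    | h a =>
      induction y using induct with
      | hp =>
          exact isClosed_eq (continuous_star'.comp (continuous_const.add continuous_id))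
            (continuous_const.add continuous_star')
      | h b => rw [← mk_add, ← mk_star, ← mk_star, ← mk_star, star_add, mk_add]

instance : CStarRing (UnivCStar rel) where
  norm_mul_self_le x := by
    induction x using induct with
    | hp =>
        exact isClosed_le (continuous_norm.mul continuous_norm)
          (continuous_norm.comp (continuous_star'.mul continuous_id))
    | h a =>
      rw [← mk_star, ← mk_mul, norm_mk, norm_mk]
      exact ((univRelSeminorm rel).star_mul_self a).ge

instance : StarModule ℂ (UnivCStar rel) where
  star_smul c x := by
    rw [Algebra.smul_def, Algebra.smul_def, star_mul, ← mk_algebraMap, ← mk_star,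
      FreeStarAlg.star_algebraMap', mk_algebraMap]
    exact (Algebra.commutes _ _).symm

instance : CStarAlgebra (UnivCStar rel) where

variable (rel)

/-- The canonical `*`-homomorphism from the free `*`-algebra. -/
def mkHom : FreeStarAlg G →⋆ₐ[ℂ] UnivCStar rel where
  toFun := mk rel
  map_one' := (mk_algebraMap (rel := rel) 1).trans (map_one _)
  map_mul' := mk_mul
  map_zero' := Completion.coe_zero (α := PreUniv rel)
  map_add' := mk_add
  commutes' := mk_algebraMap
  map_star' := mk_star

/-- The canonical generators. -/
def gen (g : G) : UnivCStar rel := mk rel (FreeStarAlg.X g)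

theorem mkHom_eq_eval : mkHom rel = FreeStarAlg.eval (gen rel) := by
  ext a
  induction a using FreeStarAlg.induct with
  | hc c => rw [AlgHomClass.commutes, AlgHomClass.commutes]
  | hl x =>
    cases x with
    | inl g => exact (FreeStarAlg.eval_X (gen rel) g).symm
    | inr g =>
      rw [← FreeStarAlg.star_X, map_star, map_star, FreeStarAlg.eval_X]
      rfl
  | hadd a b ha hb => rw [map_add, map_add, ha, hb]
  | hmul a b ha hb => rw [map_mul, map_mul, ha, hb]

/-- The canonical generators satisfy the relations. -/
theorem gen_rel (a b : FreeStarAlg G) (h : rel a b) :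
    FreeStarAlg.eval (gen rel) a = FreeStarAlg.eval (gen rel) b := by
  rw [← mkHom_eq_eval, ← sub_eq_zero, ← map_sub, ← norm_eq_zero]
  exact (norm_mk _).trans ((univRelSeminorm rel).rel' a b h)

/-- The universal property: every family in a C*-algebra that satisfies the relations is the image
of the canonical generators under exactly one unital `*`-homomorphism. -/
theorem existsUnique_lift {B : Type v} [CStarAlgebra B] (f : G → B)
    (hf : ∀ a b, rel a b → FreeStarAlg.eval f a = FreeStarAlg.eval f b) :
    ∃! φ : UnivCStar rel →⋆ₐ[ℂ] B, ∀ g, φ (gen rel g) = f g := by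
  let e : PreUniv rel → B := FreeStarAlg.eval f
  have hle : ∀ a b : PreUniv rel, dist (e a) (e b) ≤ dist a b := fun a b => by
    rw [dist_eq_norm, dist_eq_norm]
    calc ‖e a - e b‖ = ‖e (a - b)‖ := congrArg norm (map_sub (FreeStarAlg.eval f) a b).symm
      _ ≤ ‖a - b‖ := RelSeminorm.le_univ (RelSeminorm.ofRep f hf) _
  have he : UniformContinuous e := (LipschitzWith.of_dist_le_mul (K := 1)
    (by simpa using hle)).uniformContinuous
  let E : UnivCStar rel → B := Completion.extension (α := PreUniv rel) e
  have hE : Continuous E := Completion.continuous_extension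
  have hmk : ∀ a, E (mk rel a) = FreeStarAlg.eval f a := fun a => Completion.extension_coe he a
  have hC : ∀ c, E (algebraMap ℂ _ c) = algebraMap ℂ _ c := fun c => by
    rw [← mk_algebraMap, hmk, AlgHomClass.commutes]
  let φ : UnivCStar rel →⋆ₐ[ℂ] B :=
    { toFun := E
      map_one' := by simpa using hC 1
      map_zero' := by simpa using hC 0
      map_mul' := fun x y => by
        induction x using induct with
        | hp =>
            exact isClosed_eq (hE.comp (continuous_id.mul continuous_const))
              (hE.mul continuous_const)
        | h a =>
          induction y using induct with
          | hp =>
              exact isClosed_eq (hE.comp (continuous_const.mul continuous_id))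
                (continuous_const.mul hE)
          | h b => rw [← mk_mul, hmk, hmk, hmk, map_mul]
      map_add' := fun x y => by
        induction x using induct with
        | hp =>
            exact isClosed_eq (hE.comp (continuous_id.add continuous_const))
              (hE.add continuous_const)
        | h a =>
          induction y using induct with
          | hp =>
              exact isClosed_eq (hE.comp (continuous_const.add continuous_id))
                (continuous_const.add hE)
          | h b => rw [← mk_add, hmk, hmk, hmk, map_add]
      commutes' := hC
      map_star' := fun x => by
        induction x using induct with
        | hp =>
        exact isClosed_eq (hE.comp continuous_star') (continuous_star.comp hE)
          | h a => rw [← mk_star, hmk, hmk, map_star] }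
  refine ⟨φ, fun g => (hmk _).trans (FreeStarAlg.eval_X f g), fun ψ hψ => ?_⟩
  have hψc : Continuous ψ := by
    open scoped CStarAlgebra in exact map_continuous ψ
  ext x
  induction x using induct with
  | hp =>
  exact isClosed_eq hψc hE
    | h a =>
    refine Eq.trans ?_ (hmk a).symm
    change ψ (mkHom rel a) = _
    rw [mkHom_eq_eval]
    induction a using FreeStarAlg.induct with
    | hc c => simp only [AlgHomClass.commutes]
    | hl x =>
      cases x with
      | inl g =>
        change ψ (FreeStarAlg.eval (gen rel) (FreeStarAlg.X g)) =
          FreeStarAlg.eval f (FreeStarAlg.X g)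
        rw [FreeStarAlg.eval_X, FreeStarAlg.eval_X, hψ]
      | inr g =>
        rw [← FreeStarAlg.star_X, map_star, map_star, map_star, FreeStarAlg.eval_X,
          FreeStarAlg.eval_X, hψ]
    | hadd a b ha hb => simp only [map_add, ha, hb]
    | hmul a b ha hb => simp only [map_mul, ha, hb]

end UnivCStar

end Universal

/-! ### The noncommutative torus, the quantum multitorus and the algebra `A_u` -/

open FreeStarAlg (X)

/-- `ω_{ij} = e^{2πi θ_{ij}}`. -/
def omega {n : ℕ} (θ : Matrix (Fin n) (Fin n) ℝ) (i j : Fin n) : ℂ :=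
  Complex.exp (2 * Real.pi * Complex.I * (θ i j : ℂ))

/-- The relations of the noncommutative torus: the generators `x_i` are unitary and
`x_i x_j = ω_{ij} x_j x_i`. -/
inductive TorusRel {n : ℕ} (θ : Matrix (Fin n) (Fin n) ℝ) :
    FreeStarAlg (Fin n) → FreeStarAlg (Fin n) → Prop
  | star_mul_self (i : Fin n) : TorusRel θ (star (X i) * X i) 1
  | mul_star_self (i : Fin n) : TorusRel θ (X i * star (X i)) 1
  | comm (i j : Fin n) : TorusRel θ (X i * X j) (omega θ i j • (X j * X i))

instance {n : ℕ} (θ : Matrix (Fin n) (Fin n) ℝ) : Admissible (TorusRel θ) where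
  bdd i := by
    refine ⟨1, fun p => ?_⟩
    have h := p.congr_rel (TorusRel.star_mul_self (θ := θ) i)
    rw [p.star_mul_self] at h
    nlinarith [p.nonneg (X i), p.one_le]

/-- The C*-algebra `C(𝕋^n_θ)` of the noncommutative `n`-torus. -/
abbrev NCTorus {n : ℕ} (θ : Matrix (Fin n) (Fin n) ℝ) : Type := UnivCStar (TorusRel θ)

/-- The canonical unitary generators `x_i` of `C(𝕋^n_θ)`. -/
def NCTorus.x {n : ℕ} (θ : Matrix (Fin n) (Fin n) ℝ) (i : Fin n) : NCTorus θ :=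
  UnivCStar.gen (TorusRel θ) i

/-- The matrix `θ^{(σ)}_{ij} = θ_{ji} + θ_{σ⁻¹(i), σ⁻¹(j)}`. -/
def twist {n : ℕ} (θ : Matrix (Fin n) (Fin n) ℝ) (σ : Equiv.Perm (Fin n)) :
    Matrix (Fin n) (Fin n) ℝ :=
  Matrix.of fun i j => θ j i + θ (σ⁻¹ i) (σ⁻¹ j)

/-- The quantum multitorus `A_θ^n = ⨁_σ C(𝕋^n_{θ^{(σ)}})`, a finite direct sum of C*-algebras. -/
abbrev Multitorus {n : ℕ} (θ : Matrix (Fin n) (Fin n) ℝ) : Type :=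
  (σ : Equiv.Perm (Fin n)) → NCTorus (twist θ σ)

/-- The generator `x_{σ,i}`: the `i`-th generator of the summand with index `σ`. -/
def Multitorus.x {n : ℕ} (θ : Matrix (Fin n) (Fin n) ℝ) (σ : Equiv.Perm (Fin n)) (i : Fin n) :
    Multitorus θ :=
  Pi.single σ (NCTorus.x (twist θ σ) i)

/-- The noncommutative variable `u_{ik}`. -/
def U {n : ℕ} (i k : Fin n) : FreeStarAlg (Fin n × Fin n) := X (i, k)

/-- The defining relations of `A_u`. -/
inductive URel {n : ℕ} (θ : Matrix (Fin n) (Fin n) ℝ) :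
    FreeStarAlg (Fin n × Fin n) → FreeStarAlg (Fin n × Fin n) → Prop
  | comm (i j k l : Fin n) : URel θ
      (U i k * U j l + omega θ j i • (U j k * U i l))
      (omega θ k l • (U i l * U j k) + (omega θ j i * omega θ k l) • (U j l * U i k))
  | sum_mul_star (k l : Fin n) : URel θ (∑ i, U i k * star (U i l)) (if k = l then 1 else 0)
  | sum_star_mul (k l : Fin n) : URel θ (∑ i, star (U i l) * U i k) (if k = l then 1 else 0)
  | mul_star (i j k : Fin n) (h : i ≠ j) : URel θ (U j k * star (U i k)) 0
  | star_mul (i j k : Fin n) (h : i ≠ j) : URel θ (star (U i k) * U j k) 0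

theorem URel.norm_le {n : ℕ} {θ : Matrix (Fin n) (Fin n) ℝ} (p : RelSeminorm (URel θ))
    (i k : Fin n) : p (U i k) ≤ 1 := by
  -- `(u* u)(u* u) = u* (1 - ∑_{j ≠ i} u_{jk} u_{jk}*) u = u* u` modulo the relations
  set u := U i k with hu
  have h1 : p ((∑ j, U j k * star (U j k)) - 1) = 0 := by
    have := p.rel' _ _ (URel.sum_mul_star (θ := θ) k k)
    rwa [if_pos rfl] at this
  have h2 : ∀ j, j ≠ i → p (star u * (U j k * star (U j k)) * u) = 0 := by
    intro j hj
    have h : p (star u * U j k - 0) = 0 := p.rel' _ _ (URel.star_mul (θ := θ) i j k hj.symm)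
    rw [sub_zero] at h
    refine le_antisymm ?_ (p.nonneg _)
    calc p (star u * (U j k * star (U j k)) * u)
        = p ((star u * U j k) * (star (U j k) * u)) := by simp only [mul_assoc]
      _ ≤ p (star u * U j k) * p (star (U j k) * u) := p.mul_le _ _
      _ = 0 := by rw [h, zero_mul]
  have h3 : p (star u * (∑ j, U j k * star (U j k) - 1) * u) = 0 := by
    refine le_antisymm ?_ (p.nonneg _)
    calc _ ≤ p (star u * (∑ j, U j k * star (U j k) - 1)) * p u := p.mul_le _ _
      _ ≤ p (star u) * p (∑ j, U j k * star (U j k) - 1) * p u :=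
          mul_le_mul_of_nonneg_right (p.mul_le _ _) (p.nonneg _)
      _ = 0 := by rw [h1, mul_zero, zero_mul]
  have h4 : p (∑ j ∈ Finset.univ.erase i, star u * (U j k * star (U j k)) * u) = 0 := by
    refine le_antisymm ?_ (p.nonneg _)
    calc _ ≤ ∑ j ∈ Finset.univ.erase i, p (star u * (U j k * star (U j k)) * u) :=
          Finset.le_sum_of_subadditive p (map_zero p.toSeminorm).le
            (map_add_le_add p.toSeminorm) _ _
      _ = 0 := Finset.sum_eq_zero fun j hj => h2 j (Finset.ne_of_mem_erase hj)
  have h5 : star u * u * (star u * u) - star u * u =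
      star u * (∑ j, U j k * star (U j k) - 1) * u -
        ∑ j ∈ Finset.univ.erase i, star u * (U j k * star (U j k)) * u := by
    rw [← Finset.add_sum_erase Finset.univ (fun j => U j k * star (U j k)) (Finset.mem_univ i),
      ← hu, ← Finset.sum_mul, ← Finset.mul_sum]
    noncomm_ring
  have h6 : p (star u * u * (star u * u) - star u * u) = 0 := by
    rw [h5]
    refine le_antisymm ?_ (p.nonneg _)
    refine (map_sub_le_add p.toSeminorm _ _).trans ?_
    rw [h3, h4, add_zero]
  have h7 : p (star u * u) * p (star u * u) ≤ p (star u * u) := by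
    rw [← p.star_mul_self (star u * u), StarMul.star_mul, star_star]
    have := map_add_le_add p.toSeminorm (star u * u * (star u * u) - star u * u) (star u * u)
    rw [sub_add_cancel] at this
    linarith
  have h8 := p.star_mul_self u
  have h9 : p (star u * u) ≤ 1 := by nlinarith [p.nonneg (star u * u)]
  nlinarith [p.nonneg u]

instance {n : ℕ} (θ : Matrix (Fin n) (Fin n) ℝ) : Admissible (URel θ) where
  bdd g := ⟨1, fun p => URel.norm_le p g.1 g.2⟩

/-- The universal C*-algebra `A_u` generated by the `u_{ik}` subject to the relations `URel`. -/
abbrev Au {n : ℕ} (θ : Matrix (Fin n) (Fin n) ℝ) : Type := UnivCStar (URel θ)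

/-- The canonical generators `u_{ik}` of `A_u`. -/
def Au.u {n : ℕ} (θ : Matrix (Fin n) (Fin n) ℝ) (i k : Fin n) : Au θ :=
  UnivCStar.gen (URel θ) (i, k)

end QMultitorus

end

noncomputable section

namespace QMultitorus

open scoped CStarAlgebra
open FreeStarAlg (X eval eval_X)

/-! Write `p_{ik} = u_{ik}^* u_{ik}`. The column relations make every `u_{ik}` a partial isometry,
and within a row the initial projections, like the final ones, are orthogonal. Each column of
projections sums to `1`; since there are as many rows as columns, positivity forces each row to sum
to `1` as well. The quadratic relation with `i = j` then gives `u_{ik} u_{il} = 0` for `k ≠ l`,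
which makes the generators normal. Cutting the four-term relation by `p_{ik}` on either side removes
its two middle terms, so that `u_{ik}` and `u_{jl}` commute up to a scalar and `p_{ik}` is central
(`URep.proj_commute`).

Expanding `∏_k ∑_i p_{ik} = 1` decomposes `1` into central projections `P_f = ∏_k p_{f(k),k}`, which
vanish unless `f` is a permutation. In the corner of `P_σ` the `u_{ik}` with `σ k ≠ i` vanish, and
the remaining ones are unitaries satisfying the torus relations for `θ^{(σ)}`. Conversely, the torus
generators placed on the graph of `σ` satisfy the relations of `A_u`, which gives maps `A_u →
C(𝕋^n_{θ^{(σ)}})`.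

Instead of an inverse map on each corner, a norm estimate is used: `x ↦ ‖P_σ x‖` induces a
C*-seminorm on the torus polynomials, hence is bounded by the universal one
(`Au.norm_mapProj_mul_le`). Summing over `σ` gives injectivity. The range is closed and contains a
dense part of every summand, which gives surjectivity. -/

theorem omega_ne_zero {n : ℕ} (θ : Matrix (Fin n) (Fin n) ℝ) (i j : Fin n) : omega θ i j ≠ 0 :=
  Complex.exp_ne_zero _

theorem omega_self {n : ℕ} {θ : Matrix (Fin n) (Fin n) ℝ} (hθ : ∀ i j, θ j i = -θ i j)
    (i : Fin n) : omega θ i i = 1 := by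
  have h : θ i i = 0 := by linarith [hθ i i]
  simp [omega, h]

theorem omega_mul_swap {n : ℕ} {θ : Matrix (Fin n) (Fin n) ℝ} (hθ : ∀ i j, θ j i = -θ i j)
    (i j : Fin n) : omega θ i j * omega θ j i = 1 := by
  simp [omega, hθ i j, ← Complex.exp_add]

/-- This is the scalar `ω_{ji} ω_{kl}` of the quadratic relation at `i = σ k`, `j = σ l`; it
explains the form of `twist`. -/
theorem omega_twist {n : ℕ} (θ : Matrix (Fin n) (Fin n) ℝ) (σ : Equiv.Perm (Fin n))
    (k l : Fin n) : omega (twist θ σ) (σ k) (σ l) = omega θ (σ l) (σ k) * omega θ k l := by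
  simp [omega, twist, ← Complex.exp_add, mul_add]

/-! ### Consequences of the relations of `A_u` in a C*-algebra -/

/-- A family in a `*`-algebra that satisfies the relations of `A_u`. -/
structure URep {n : ℕ} (θ : Matrix (Fin n) (Fin n) ℝ) {A : Type*} [CStarAlgebra A]
    (u : Fin n → Fin n → A) : Prop where
  comm : ∀ i j k l, u i k * u j l + omega θ j i • (u j k * u i l) =
    omega θ k l • (u i l * u j k) + (omega θ j i * omega θ k l) • (u j l * u i k)
  sum_mul_star : ∀ k l, ∑ i, u i k * star (u i l) = if k = l then 1 else 0
  sum_star_mul : ∀ k l, ∑ i, star (u i l) * u i k = if k = l then 1 else 0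
  mul_star : ∀ i j k, i ≠ j → u j k * star (u i k) = 0
  star_mul : ∀ i j k, i ≠ j → star (u i k) * u j k = 0

/-- Projections are positive, being of the form `a^* a`, and positive elements with sum zero all
vanish. The spectral order is introduced locally for this argument. -/
theorem sum_eq_one_of_isStarProjection {A ι : Type*} [CStarAlgebra A] [Fintype ι]
    {e : ι → A} (he : ∀ i, IsStarProjection (1 - e i)) (hsum : ∑ i, (1 - e i) = 0) (i : ι) :
    e i = 1 := by
  let _ := CStarAlgebra.spectralOrder A
  have := CStarAlgebra.spectralOrderedRing A
  have h0 : ∀ i ∈ Finset.univ, 0 ≤ 1 - e i := fun i _ => by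
    have := star_mul_self_nonneg (1 - e i)
    rwa [(he i).isSelfAdjoint.star_eq, (he i).isIdempotentElem.eq] at this
  exact (sub_eq_zero.1 ((Finset.sum_eq_zero_iff_of_nonneg h0).1 hsum i (Finset.mem_univ i))).symm

namespace URep

variable {n : ℕ} {θ : Matrix (Fin n) (Fin n) ℝ} {A : Type*} [CStarAlgebra A]
  {u : Fin n → Fin n → A}

/-- Multiply `∑_j u_{jk} u_{jk}^* = 1` on the right by `u_{ik}`: column orthogonality leaves only `j
= i`. -/
theorem mul_star_mul (h : URep θ u) (i k : Fin n) : u i k * star (u i k) * u i k = u i k := by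
  have h1 := congrArg (· * u i k) (h.sum_mul_star k k)
  simp only [if_true, one_mul, Finset.sum_mul] at h1
  rwa [Finset.sum_eq_single i] at h1
  · intro j _ hj
    rw [mul_assoc, h.star_mul j i k hj, mul_zero]
  · simp

theorem star_mul_star (h : URep θ u) (i k : Fin n) :
    star (u i k) * u i k * star (u i k) = star (u i k) := by
  simpa [mul_assoc] using congrArg star (h.mul_star_mul i k)

/-- Multiplying the off-diagonal sum relation by `u_{ik}^*` isolates the term of row `i`; the
partial isometry identity then removes the extra factors. -/
theorem mul_star_of_ne (h : URep θ u) (i : Fin n) {k l : Fin n} (hkl : k ≠ l) :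
    u i k * star (u i l) = 0 := by
  have h1 := congrArg (star (u i k) * ·) (h.sum_mul_star k l)
  simp only [if_neg hkl, mul_zero, Finset.mul_sum] at h1
  rw [Finset.sum_eq_single i] at h1
  · rw [← h.mul_star_mul i k, mul_assoc, mul_assoc, h1, mul_zero]
  · intro j _ hj
    rw [← mul_assoc, h.star_mul i j k hj.symm, zero_mul]
  · simp

theorem star_mul_of_ne (h : URep θ u) (i : Fin n) {k l : Fin n} (hkl : k ≠ l) :
    star (u i k) * u i l = 0 := by
  have h1 := congrArg (· * star (u i l)) (h.sum_star_mul l k)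
  simp only [if_neg hkl.symm, zero_mul, Finset.sum_mul] at h1
  rw [Finset.sum_eq_single i] at h1
  · rw [← h.mul_star_mul i l, mul_assoc, ← mul_assoc, ← mul_assoc, h1, zero_mul]
  · intro j _ hj
    rw [mul_assoc, h.mul_star i j l hj.symm, mul_zero]
  · simp

theorem isStarProjection_star_mul (h : URep θ u) (i k : Fin n) :
    IsStarProjection (star (u i k) * u i k) where
  isSelfAdjoint := IsSelfAdjoint.star_mul_self _
  isIdempotentElem := by
    rw [IsIdempotentElem, ← mul_assoc, h.star_mul_star]

theorem isStarProjection_mul_star (h : URep θ u) (i k : Fin n) :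
    IsStarProjection (u i k * star (u i k)) where
  isSelfAdjoint := IsSelfAdjoint.mul_star_self _
  isIdempotentElem := by
    rw [IsIdempotentElem, ← mul_assoc, h.mul_star_mul]

theorem _root_.IsStarProjection.sum_of_mul_eq_zero {A ι : Type*} [CStarAlgebra A] [Fintype ι]
    {p : ι → A} (hp : ∀ i, IsStarProjection (p i)) (h0 : ∀ i j, i ≠ j → p i * p j = 0) :
    IsStarProjection (∑ i, p i) where
  isSelfAdjoint := by
    rw [IsSelfAdjoint, star_sum]
    exact Finset.sum_congr rfl fun i _ => (hp i).isSelfAdjoint.star_eq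
  isIdempotentElem := by
    rw [IsIdempotentElem, Finset.sum_mul_sum]
    refine Finset.sum_congr rfl fun i _ => ?_
    rw [Finset.sum_eq_single i (fun j _ hj => h0 i j hj.symm) (by simp)]
    exact (hp i).isIdempotentElem

/-- The defects `1 - ∑_k p_{ik}` are projections. Their sum over `i` is `n` minus the total of all
columns, which is again `n` because the array is square; so each defect is zero. -/
theorem row_sum_eq_one {p : Fin n → Fin n → A} (hp : ∀ i k, IsStarProjection (p i k))
    (hcol : ∀ k, ∑ i, p i k = 1) (h0 : ∀ i k l, k ≠ l → p i k * p i l = 0) (i : Fin n) :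
    ∑ k, p i k = 1 := by
  refine sum_eq_one_of_isStarProjection (e := fun i => ∑ k, p i k)
    (fun i => (IsStarProjection.sum_of_mul_eq_zero (hp i) (h0 i)).one_sub) ?_ i
  rw [Finset.sum_sub_distrib, Finset.sum_comm, Finset.sum_congr rfl fun k _ => hcol k, sub_self]

theorem row_sum_star_mul (h : URep θ u) (i : Fin n) : ∑ k, star (u i k) * u i k = 1 := by
  refine row_sum_eq_one (p := fun i k => star (u i k) * u i k) h.isStarProjection_star_mul
    (fun k => by simpa using h.sum_star_mul k k) (fun i k l hkl => ?_) i
  rw [mul_assoc, ← mul_assoc (u i k), h.mul_star_of_ne i hkl, zero_mul, mul_zero]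

theorem row_sum_mul_star (h : URep θ u) (i : Fin n) : ∑ k, u i k * star (u i k) = 1 := by
  refine row_sum_eq_one (p := fun i k => u i k * star (u i k)) h.isStarProjection_mul_star
    (fun k => by simpa using h.sum_mul_star k k) (fun i k l hkl => ?_) i
  rw [mul_assoc, ← mul_assoc (star (u i k)), h.star_mul_of_ne i hkl, zero_mul, mul_zero]

/-- For `i = j` the relation reads `2 u_{ik} u_{il} = 2 ω_{kl} u_{il} u_{ik}`. Inserting `u_{ik}
u_{ik}^*` on the left produces the factor `u_{ik}^* u_{il} = 0`. -/
theorem mul_row_of_ne (hθ : ∀ i j, θ j i = -θ i j) (h : URep θ u) (i : Fin n) {k l : Fin n}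
    (hkl : k ≠ l) : u i k * u i l = 0 := by
  have h1 := h.comm i i k l
  rw [omega_self hθ, one_smul, one_mul, ← two_smul ℂ, ← two_smul ℂ] at h1
  have h2 := smul_right_injective A (two_ne_zero (α := ℂ)) h1
  rw [← h.mul_star_mul i k, mul_assoc, mul_assoc, h2, mul_smul_comm, ← mul_assoc (star _),
    h.star_mul_of_ne i hkl, zero_mul, smul_zero, mul_zero]

/-- The generators are normal. -/
theorem star_mul_eq_mul_star (hθ : ∀ i j, θ j i = -θ i j) (h : URep θ u) (i k : Fin n) :
    star (u i k) * u i k = u i k * star (u i k) := by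
  -- The product of initial and final projection equals each of them: expand `1` as a row sum on one
  -- side or the other, and row orthogonality kills every other term.
  have h1 : star (u i k) * u i k * (u i k * star (u i k)) = star (u i k) * u i k := by
    conv_rhs => rw [← mul_one (star (u i k) * u i k), ← h.row_sum_mul_star i, Finset.mul_sum]
    rw [Finset.sum_eq_single k]
    · intro l _ hl
      rw [mul_assoc, ← mul_assoc (u i k), h.mul_row_of_ne hθ i hl.symm, zero_mul, mul_zero]
    · simp
  have h2 : star (u i k) * u i k * (u i k * star (u i k)) = u i k * star (u i k) := by
    conv_rhs => rw [← one_mul (u i k * star (u i k)), ← h.row_sum_star_mul i, Finset.sum_mul]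
    rw [Finset.sum_eq_single k]
    · intro l _ hl
      rw [mul_assoc, ← mul_assoc (u i l), h.mul_row_of_ne hθ i hl, zero_mul, mul_zero]
    · simp
  exact h1.symm.trans h2

theorem proj_mul_self (hθ : ∀ i j, θ j i = -θ i j) (h : URep θ u) (i k : Fin n) :
    star (u i k) * u i k * u i k = u i k := by
  rw [h.star_mul_eq_mul_star hθ, h.mul_star_mul]

theorem proj_mul_row (hθ : ∀ i j, θ j i = -θ i j) (h : URep θ u) (i : Fin n) {k l : Fin n}
    (hkl : k ≠ l) :
    star (u i k) * u i k * u i l = 0 := by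
  rw [mul_assoc, h.mul_row_of_ne hθ i hkl, mul_zero]

theorem proj_mul_col (hθ : ∀ i j, θ j i = -θ i j) (h : URep θ u) {i j : Fin n} (k : Fin n)
    (hij : i ≠ j) : star (u i k) * u i k * u j k = 0 := by
  rw [h.star_mul_eq_mul_star hθ, mul_assoc, h.star_mul i j k hij, mul_zero]

theorem mul_proj_row (h : URep θ u) (i : Fin n) {k l : Fin n} (hkl : k ≠ l) :
    u i l * (star (u i k) * u i k) = 0 := by
  rw [← mul_assoc, h.mul_star_of_ne i hkl.symm, zero_mul]

theorem mul_proj_col (h : URep θ u) {i j : Fin n} (k : Fin n) (hij : i ≠ j) :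
    u j k * (star (u i k) * u i k) = 0 := by
  rw [← mul_assoc, h.mul_star i j k hij, zero_mul]

/-- Left multiplication by `p_{ik}` fixes `u_{ik} u_{jl}` and annihilates the two middle terms,
which begin with `u_{jk}` and `u_{il}`. -/
theorem mul_eq_smul_proj_mul (hθ : ∀ i j, θ j i = -θ i j) (h : URep θ u) {i j k l : Fin n}
    (hij : i ≠ j) (hkl : k ≠ l) : u i k * u j l =
      (omega θ j i * omega θ k l) • (star (u i k) * u i k * (u j l * u i k)) := by
  have h1 := congrArg (star (u i k) * u i k * ·) (h.comm i j k l)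
  simp only [mul_add, mul_smul_comm] at h1
  simpa only [← mul_assoc, h.proj_mul_self hθ, h.proj_mul_col hθ k hij, h.proj_mul_row hθ i hkl,
    zero_mul, smul_zero, add_zero, zero_add] using h1

theorem mul_proj_eq_smul_mul (h : URep θ u) {i j k l : Fin n}
    (hij : i ≠ j) (hkl : k ≠ l) : u i k * u j l * (star (u i k) * u i k) =
      (omega θ j i * omega θ k l) • (u j l * u i k) := by
  have h1 := congrArg (· * (star (u i k) * u i k)) (h.comm i j k l)
  simp only [add_mul, smul_mul_assoc] at h1
  have h2 : u i k * (star (u i k) * u i k) = u i k := by rw [← mul_assoc, h.mul_star_mul]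
  simpa only [mul_assoc (u _ _) (u _ _) (_ * _), h2, h.mul_proj_col k hij, h.mul_proj_row i hkl,
    mul_zero, smul_zero, add_zero, zero_add] using h1

theorem mul_proj (h : URep θ u) (i k : Fin n) : u i k * (star (u i k) * u i k) = u i k := by
  rw [← mul_assoc, h.mul_star_mul]

/-- By `mul_eq_smul_proj_mul` the product can be rewritten so that it ends in `u_{ik}`, which
absorbs `p_{ik}` on the right. -/
theorem mul_mul_proj (hθ : ∀ i j, θ j i = -θ i j) (h : URep θ u) {i j k l : Fin n}
    (hij : i ≠ j) (hkl : k ≠ l) : u i k * u j l * (star (u i k) * u i k) = u i k * u j l := by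
  rw [h.mul_eq_smul_proj_mul hθ hij hkl, smul_mul_assoc]
  simp only [mul_assoc (star (u i k) * u i k), mul_assoc (u j l), h.mul_proj]

/-- The generators commute up to a scalar. -/
theorem mul_eq_smul_mul (hθ : ∀ i j, θ j i = -θ i j) (h : URep θ u) {i j k l : Fin n}
    (hij : i ≠ j) (hkl : k ≠ l) :
    u i k * u j l = (omega θ j i * omega θ k l) • (u j l * u i k) := by
  rw [← h.mul_proj_eq_smul_mul hij hkl, h.mul_mul_proj hθ hij hkl]

/-- The projections `u_{ik}^* u_{ik}` commute with all generators. -/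
theorem proj_commute (hθ : ∀ i j, θ j i = -θ i j) (h : URep θ u) (i j k l : Fin n) :
    Commute (star (u i k) * u i k) (u j l) := by
  rw [commute_iff_eq]
  by_cases hij : i = j
  · subst hij
    by_cases hkl : k = l
    · subst hkl
      rw [h.proj_mul_self hθ, h.mul_proj]
    · rw [h.proj_mul_row hθ i hkl, h.mul_proj_row i hkl]
  by_cases hkl : k = l
  · subst hkl
    rw [h.proj_mul_col hθ k hij, h.mul_proj_col k hij]
  -- In the generic case, `p u p = p u` and `p u p = u p` are shown separately for `p = p_{ik}`, `u
  -- = u_{jl}`.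
  have h1 : star (u i k) * u i k * u j l * (star (u i k) * u i k) =
      star (u i k) * u i k * u j l := by
    simpa only [← mul_assoc] using congrArg (star (u i k) * ·) (h.mul_mul_proj hθ hij hkl)
  have h2 : star (u i k) * u i k * (u j l * u i k) = u j l * u i k := by
    refine smul_right_injective A
      (mul_ne_zero (omega_ne_zero θ j i) (omega_ne_zero θ k l)) ?_
    exact (h.mul_eq_smul_proj_mul hθ hij hkl).symm.trans (h.mul_eq_smul_mul hθ hij hkl)
  -- Normality turns the factor `u_{ik} u_{ik}^*` on the right into `p_{ik}`.
  have h3 := congrArg (· * star (u i k)) h2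
  simp only [mul_assoc (u j l), ← h.star_mul_eq_mul_star hθ,
    mul_assoc (star (u i k) * u i k)] at h3
  rw [← h1, mul_assoc, h3]

end URep

/-! ### Corner seminorms and reduction to generators -/

/-- The seminorm that a representation of the relations in the corner of a central projection
induces. -/
def RelSeminorm.ofCorner {G : Type*} {rel : FreeStarAlg G → FreeStarAlg G → Prop} {B : Type*}
    [CStarAlgebra B] (f : G → B) {P : B} (hP : IsStarProjection P)
    (hc : ∀ b, Commute P b)
    (hf : ∀ a b, rel a b → P * eval f a = P * eval f b) : RelSeminorm rel where
  __ := (normSeminorm ℂ B).comp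
    ((LinearMap.mulLeft ℂ P).comp (eval f).toAlgHom.toLinearMap)
  mul_le' a b := by
    change ‖P * eval f (a * b)‖ ≤ ‖P * eval f a‖ * ‖P * eval f b‖
    have : P * eval f (a * b) = (P * eval f a) * (P * eval f b) := by
      rw [map_mul, mul_assoc P _ (P * _), ← mul_assoc _ P, ← (hc (eval f a)).eq,
        mul_assoc P _ (eval f b), ← mul_assoc P P, hP.isIdempotentElem.eq]
    rw [this]
    exact norm_mul_le _ _
  star_mul_self' a := by
    change ‖P * eval f (star a * a)‖ = ‖P * eval f a‖ * ‖P * eval f a‖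
    rw [← CStarRing.norm_star_mul_self, map_mul, map_star, star_mul, hP.isSelfAdjoint.star_eq,
      mul_assoc, ← mul_assoc P P, hP.isIdempotentElem.eq, ← mul_assoc, ← mul_assoc, (hc _).eq]
  rel' a b h := by
    change ‖P * eval f (a - b)‖ = 0
    rw [map_sub, mul_sub, hf a b h, sub_self, norm_zero]

theorem FreeStarAlg.induct_X {G : Type*} {p : FreeStarAlg G → Prop}
    (hc : ∀ c, p (algebraMap ℂ _ c)) (hX : ∀ g, p (X g)) (hstar : ∀ a, p a → p (star a))
    (hadd : ∀ a b, p a → p b → p (a + b)) (hmul : ∀ a b, p a → p b → p (a * b))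
    (a : FreeStarAlg G) : p a := by
  induction a using FreeStarAlg.induct with
  | hc c => exact hc c
  | hl x =>
    cases x with
    | inl g => exact hX g
    | inr g => rw [← FreeStarAlg.star_X]; exact hstar _ (hX g)
  | hadd a b ha hb => exact hadd a b ha hb
  | hmul a b ha hb => exact hmul a b ha hb

theorem FreeStarAlg.eval_star_X {G : Type*} {B : Type*} [CStarAlgebra B] (f : G → B) (g : G) :
    eval f (star (X g)) = star (f g) := by
  rw [map_star, eval_X]

/-- Self-adjointness of `P` makes its commutant closed under `star`, so the generators suffice on
polynomials; continuity gives the completion. -/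
theorem UnivCStar.commute_of_gen {G : Type*} {rel : FreeStarAlg G → FreeStarAlg G → Prop}
    [Admissible rel] {P : UnivCStar rel} (hP : IsSelfAdjoint P)
    (h : ∀ g, Commute P (gen rel g)) (x : UnivCStar rel) : Commute P x := by
  induction x using UnivCStar.induct with
  | hp =>
    exact isClosed_eq (continuous_const.mul continuous_id) (continuous_id.mul continuous_const)
  | h a =>
    induction a using FreeStarAlg.induct_X with
    | hc c => exact Algebra.commute_algebraMap_right c P
    | hX g => exact h g
    | hstar a ha => rw [mk_star, ← hP.star_eq]; exact ha.star_star
    | hadd a b ha hb => rw [mk_add]; exact ha.add_right hb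
    | hmul a b ha hb => rw [mk_mul]; exact ha.mul_right hb

/-! ### The central projections of `A_u` -/

section Au

variable {n : ℕ} {θ : Matrix (Fin n) (Fin n) ℝ}

theorem urep_iff {A : Type*} [CStarAlgebra A] (u : Fin n → Fin n → A) : URep θ u ↔
    ∀ a b, URel θ a b →
      eval (fun g : Fin n × Fin n => u g.1 g.2) a = eval (fun g => u g.1 g.2) b := by
  constructor
  · rintro h a b (⟨i, j, k, l⟩ | ⟨k, l⟩ | ⟨k, l⟩ | ⟨i, j, k, hij⟩ | ⟨i, j, k, hij⟩)
    · simpa [U, eval_X, FreeStarAlg.eval_star_X] using h.comm i j k l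
    · have := h.sum_mul_star k l
      split_ifs at this ⊢ <;> simpa [U, eval_X, FreeStarAlg.eval_star_X] using this
    · have := h.sum_star_mul k l
      split_ifs at this ⊢ <;> simpa [U, eval_X, FreeStarAlg.eval_star_X] using this
    · simpa [U, eval_X, FreeStarAlg.eval_star_X] using h.mul_star i j k hij
    · simpa [U, eval_X, FreeStarAlg.eval_star_X] using h.star_mul i j k hij
  · refine fun h => ⟨fun i j k l => ?_, fun k l => ?_, fun k l => ?_, fun i j k hij => ?_,
      fun i j k hij => ?_⟩
    · simpa [U, eval_X, FreeStarAlg.eval_star_X] using h _ _ (.comm i j k l)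
    · have := h _ _ (.sum_mul_star k l)
      split_ifs at this ⊢ <;> simpa [U, eval_X, FreeStarAlg.eval_star_X] using this
    · have := h _ _ (.sum_star_mul k l)
      split_ifs at this ⊢ <;> simpa [U, eval_X, FreeStarAlg.eval_star_X] using this
    · simpa [U, eval_X, FreeStarAlg.eval_star_X] using h _ _ (.mul_star i j k hij)
    · simpa [U, eval_X, FreeStarAlg.eval_star_X] using h _ _ (.star_mul i j k hij)

theorem Au.urep (θ : Matrix (Fin n) (Fin n) ℝ) : URep θ (Au.u θ) :=
  (urep_iff _).2 (UnivCStar.gen_rel (URel θ))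

/-- Membership in the commutative ring `Subring.center` is what makes finite products of these
projections, and the expansion of a product of sums, available. -/
theorem Au.star_mul_mem_center (hθ : ∀ i j, θ j i = -θ i j) (i k : Fin n) :
    star (Au.u θ i k) * Au.u θ i k ∈ Subring.center (Au θ) := by
  refine Subring.mem_center_iff.2 fun x => Eq.symm ?_
  exact UnivCStar.commute_of_gen (rel := URel θ) (IsSelfAdjoint.star_mul_self (Au.u θ i k))
    (fun g => (Au.urep θ).proj_commute hθ i g.1 k g.2) x

/-- The projections `u_{ik}^* u_{ik}`, as elements of the centre of `A_u`. -/
def Au.proj (hθ : ∀ i j, θ j i = -θ i j) (i k : Fin n) : Subring.center (Au θ) :=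
  ⟨star (Au.u θ i k) * Au.u θ i k, Au.star_mul_mem_center hθ i k⟩

/-- The central projection of the summand with index `f` (zero if `f` is not a permutation). -/
def Au.mapProj (hθ : ∀ i j, θ j i = -θ i j) (f : Fin n → Fin n) : Subring.center (Au θ) :=
  ∏ k, Au.proj hθ (f k) k

/-- Expand `∏_k ∑_i p_{ik}`, each factor being `1`; a choice of `i` for every `k` is a function `f`.
-/
theorem Au.sum_mapProj (hθ : ∀ i j, θ j i = -θ i j) : ∑ f, Au.mapProj hθ f = 1 := by
  have h : ∀ k, ∑ i, Au.proj hθ i k = 1 := fun k => by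
    ext
    simpa [Au.proj] using (Au.urep θ).sum_star_mul k k
  simp only [Au.mapProj]
  rw [← Fintype.prod_sum fun k i => Au.proj hθ i k]
  simp [h]

theorem Au.mapProj_eq_mul (hθ : ∀ i j, θ j i = -θ i j) (f : Fin n → Fin n) (k : Fin n) :
    Au.mapProj hθ f = (∏ l ∈ Finset.univ.erase k, Au.proj hθ (f l) l) * Au.proj hθ (f k) k :=
  (Finset.prod_erase_mul _ _ (Finset.mem_univ k)).symm

theorem Au.proj_mul_proj (hθ : ∀ i j, θ j i = -θ i j) (i : Fin n) {k l : Fin n} (hkl : k ≠ l) :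
    Au.proj hθ i k * Au.proj hθ i l = 0 := by
  ext
  change star (Au.u θ i k) * Au.u θ i k * (star (Au.u θ i l) * Au.u θ i l) = 0
  rw [mul_assoc, ← mul_assoc (Au.u θ i k), (Au.urep θ).mul_star_of_ne i hkl, zero_mul, mul_zero]

/-- If `f k = f l`, the product contains two orthogonal projections of the same row. -/
theorem Au.mapProj_eq_zero (hθ : ∀ i j, θ j i = -θ i j) {f : Fin n → Fin n}
    (hf : ¬ Function.Injective f) : Au.mapProj hθ f = 0 := by
  simp only [Function.Injective, not_forall] at hf
  obtain ⟨k, l, hfkl, hkl⟩ := hf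
  rw [Au.mapProj_eq_mul hθ f k,
    ← Finset.prod_erase_mul _ _ (Finset.mem_erase.2 ⟨Ne.symm hkl, Finset.mem_univ l⟩), hfkl,
    mul_assoc, Au.proj_mul_proj hθ _ (Ne.symm hkl), mul_zero]

theorem Au.isStarProjection_mapProj (hθ : ∀ i j, θ j i = -θ i j) (f : Fin n → Fin n) :
    IsStarProjection (Au.mapProj hθ f : Au θ) := by
  refine Finset.prod_induction (fun k => Au.proj hθ (f k) k)
    (fun z => IsStarProjection (z : Au θ)) (fun a b ha hb => ?_) ?_ fun k _ =>
      (Au.urep θ).isStarProjection_star_mul (f k) k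
  · exact ha.mul hb (Subring.mem_center_iff.1 a.2 b).symm
  · exact IsStarProjection.one _

theorem Au.mapProj_commute (hθ : ∀ i j, θ j i = -θ i j) (f : Fin n → Fin n) (x : Au θ) :
    Commute (Au.mapProj hθ f : Au θ) x :=
  (Subring.mem_center_iff.1 (Au.mapProj hθ f).2 x).symm

theorem Au.mapProj_mul_proj (hθ : ∀ i j, θ j i = -θ i j) (f : Fin n → Fin n) (k : Fin n) :
    (Au.mapProj hθ f : Au θ) * (star (Au.u θ (f k) k) * Au.u θ (f k) k) = Au.mapProj hθ f := by
  rw [Au.mapProj_eq_mul hθ f k]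
  simp only [Subring.coe_mul]
  rw [mul_assoc]
  exact congrArg _ ((Au.urep θ).isStarProjection_star_mul (f k) k).isIdempotentElem.eq

theorem Au.mapProj_mul_u (hθ : ∀ i j, θ j i = -θ i j) (f : Fin n → Fin n) {i k : Fin n}
    (h : f k ≠ i) : (Au.mapProj hθ f : Au θ) * Au.u θ i k = 0 := by
  rw [← Au.mapProj_mul_proj hθ f k, mul_assoc, (Au.urep θ).proj_mul_col hθ k h, mul_zero]

/-! ### The maps from `A_u` to the noncommutative tori -/

variable (θ) in
/-- The images of the generators of `A_u` in the summand with index `σ`. -/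
def torusU (σ : Equiv.Perm (Fin n)) (i k : Fin n) : NCTorus (twist θ σ) :=
  if σ k = i then NCTorus.x (twist θ σ) i else 0

theorem NCTorus.star_x_mul_x (η : Matrix (Fin n) (Fin n) ℝ) (i : Fin n) :
    star (NCTorus.x η i) * NCTorus.x η i = 1 := by
  simpa [NCTorus.x, eval_X, FreeStarAlg.eval_star_X] using
    UnivCStar.gen_rel _ _ _ (TorusRel.star_mul_self (θ := η) i)

theorem NCTorus.x_mul_star_x (η : Matrix (Fin n) (Fin n) ℝ) (i : Fin n) :
    NCTorus.x η i * star (NCTorus.x η i) = 1 := by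
  simpa [NCTorus.x, eval_X, FreeStarAlg.eval_star_X] using
    UnivCStar.gen_rel _ _ _ (TorusRel.mul_star_self (θ := η) i)

theorem NCTorus.x_mul_x (η : Matrix (Fin n) (Fin n) ℝ) (i j : Fin n) :
    NCTorus.x η i * NCTorus.x η j = omega η i j • (NCTorus.x η j * NCTorus.x η i) := by
  simpa [NCTorus.x, eval_X, FreeStarAlg.eval_star_X] using
    UnivCStar.gen_rel _ _ _ (TorusRel.comm (θ := η) i j)

theorem torusU_urep (hθ : ∀ i j, θ j i = -θ i j) (σ : Equiv.Perm (Fin n)) :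
    URep θ (torusU θ σ) where
  comm i j k l := by
    by_cases hkl : k = l
    · subst hkl
      by_cases hij : i = j
      · subst hij
        simp [omega_self hθ]
      · have h : ∀ a b, a ≠ b → torusU θ σ a k * torusU θ σ b k = 0 := by
          intro a b hab
          by_cases ha : σ k = a
          · simp [torusU, show σ k ≠ b from fun hb => hab (ha.symm.trans hb)]
          · simp [torusU, ha]
        simp [h i j hij, h j i (Ne.symm hij)]
    · by_cases h1 : σ k = i ∧ σ l = j
      · obtain ⟨rfl, rfl⟩ := h1
        -- Only the two outer terms survive, and the relation becomes the torus commutation with the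
        -- twisted scalar.
        simp [torusU, hkl, Ne.symm hkl, NCTorus.x_mul_x _ (σ k) (σ l), omega_twist]
      · have h1' : torusU θ σ i k * torusU θ σ j l = 0 := by
          rw [torusU, torusU]; split_ifs <;> simp_all
        have h1'' : torusU θ σ j l * torusU θ σ i k = 0 := by
          rw [torusU, torusU]; split_ifs <;> simp_all
        rw [h1', h1'']
        by_cases h2 : σ k = j ∧ σ l = i
        · obtain ⟨rfl, rfl⟩ := h2
          -- Only the two middle terms survive; here `ω_{ji}` cancels the `ω_{ij}` contained in the
          -- twisted scalar.
          simp only [torusU, if_true, zero_add, smul_zero, add_zero]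
          rw [NCTorus.x_mul_x _ (σ k) (σ l), omega_twist, smul_smul, ← mul_assoc,
            omega_mul_swap hθ, one_mul]
        · have h2' : torusU θ σ j k * torusU θ σ i l = 0 := by
            rw [torusU, torusU]; split_ifs <;> simp_all
          have h2'' : torusU θ σ i l * torusU θ σ j k = 0 := by
            rw [torusU, torusU]; split_ifs <;> simp_all
          simp [h2', h2'']
  sum_mul_star k l := by
    rw [Finset.sum_eq_single (σ k) (fun i _ hi => by simp [torusU, hi.symm]) (by simp)]
    by_cases hkl : k = l
    · simp [torusU, hkl, NCTorus.x_mul_star_x]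
    · simp [torusU, hkl, Ne.symm hkl]
  sum_star_mul k l := by
    rw [Finset.sum_eq_single (σ k) (fun i _ hi => by simp [torusU, hi.symm]) (by simp)]
    by_cases hkl : k = l
    · simp [torusU, hkl, NCTorus.star_x_mul_x]
    · simp [torusU, hkl, Ne.symm hkl]
  mul_star i j k hij := by
    rw [torusU, torusU]; split_ifs <;> simp_all
  star_mul i j k hij := by
    rw [torusU, torusU]; split_ifs <;> simp_all

/-- The projection of `A_u` onto the summand with index `σ`. -/
def Au.toTorus (hθ : ∀ i j, θ j i = -θ i j) (σ : Equiv.Perm (Fin n)) :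
    Au θ →⋆ₐ[ℂ] NCTorus (twist θ σ) :=
  (UnivCStar.existsUnique_lift (URel θ) _ ((urep_iff _).1 (torusU_urep hθ σ))).choose

theorem Au.toTorus_u (hθ : ∀ i j, θ j i = -θ i j) (σ : Equiv.Perm (Fin n)) (i k : Fin n) :
    Au.toTorus hθ σ (Au.u θ i k) = torusU θ σ i k :=
  (UnivCStar.existsUnique_lift (URel θ) _
    ((urep_iff _).1 (torusU_urep hθ σ))).choose_spec.1 (i, k)

/-- In the corner of `σ`, the generators `u_{i, σ⁻¹ i}` satisfy the relations of the torus. -/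
theorem Au.mapProj_mul_torusRel (hθ : ∀ i j, θ j i = -θ i j) (σ : Equiv.Perm (Fin n))
    (a b : FreeStarAlg (Fin n)) (h : TorusRel (twist θ σ) a b) :
    (Au.mapProj hθ σ : Au θ) * eval (fun i => Au.u θ i (σ⁻¹ i)) a =
      (Au.mapProj hθ σ : Au θ) * eval (fun i => Au.u θ i (σ⁻¹ i)) b := by
  have hp : ∀ i, (Au.mapProj hθ σ : Au θ) * (star (Au.u θ i (σ⁻¹ i)) * Au.u θ i (σ⁻¹ i)) =
      Au.mapProj hθ σ := fun i => by
    simpa using Au.mapProj_mul_proj hθ σ (σ⁻¹ i)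
  rcases h with i | i | ⟨i, j⟩
  · simpa only [map_mul, map_star, eval_X, map_one, mul_one] using hp i
  · rw [map_mul, map_star, eval_X, ← (Au.urep θ).star_mul_eq_mul_star hθ, map_one, mul_one, hp i]
  · by_cases hij : i = j
    -- The scalar commutation lemma needs distinct indices; on the diagonal the scalar is `1`
    -- because the twisted matrix is again skew-symmetric.
    · subst hij
      rw [omega_self fun i j => ?_, one_smul]
      simp only [twist, Matrix.of_apply]
      rw [hθ, hθ (σ⁻¹ i)]
      ring
    · simp only [map_mul, map_smul, eval_X]
      rw [(Au.urep θ).mul_eq_smul_mul hθ hij (fun h => hij (σ⁻¹.injective h))]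
      have := omega_twist θ σ (σ⁻¹ i) (σ⁻¹ j)
      rw [show σ (σ⁻¹ i) = i from σ.apply_symm_apply i,
        show σ (σ⁻¹ j) = j from σ.apply_symm_apply j] at this
      rw [this]

/-- This replaces an inverse map on the corner. On polynomials both sides depend only on the image
under the substitution that sets the `u_{ik}` with `σ k ≠ i` to zero; the left side is then a corner
seminorm and the right side the universal norm of the torus. -/
theorem Au.norm_mapProj_mul_le (hθ : ∀ i j, θ j i = -θ i j) (σ : Equiv.Perm (Fin n))
    (x : Au θ) : ‖(Au.mapProj hθ σ : Au θ) * x‖ ≤ ‖Au.toTorus hθ σ x‖ := by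
  induction x using UnivCStar.induct with
  | hp =>
    exact isClosed_le (continuous_norm.comp (continuous_const.mul continuous_id))
      (continuous_norm.comp (map_continuous (Au.toTorus hθ σ)))
  | h a =>
    set g : Fin n × Fin n → FreeStarAlg (Fin n) := fun g => if σ g.2 = g.1 then X g.1 else 0
    have h1 : (Au.mapProj hθ σ : Au θ) * UnivCStar.mk _ a =
        (Au.mapProj hθ σ : Au θ) * eval (fun i => Au.u θ i (σ⁻¹ i)) (eval g a) := by
      change _ * UnivCStar.mkHom _ a = _
      have hc := Au.mapProj_commute hθ (σ : Fin n → Fin n)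
      have hs := (Au.isStarProjection_mapProj hθ (σ : Fin n → Fin n)).isSelfAdjoint.star_eq
      induction a using FreeStarAlg.induct_X with
      | hc c => simp only [AlgHomClass.commutes]
      | hX q =>
        rw [eval_X]
        change _ * Au.u θ q.1 q.2 = _
        simp only [g]
        split_ifs with hq
        · rw [eval_X, ← hq, Equiv.Perm.inv_def, Equiv.symm_apply_apply]
        · rw [map_zero, mul_zero, Au.mapProj_mul_u hθ _ hq]
      | hstar a ha =>
        have := congrArg star ha
        simpa only [map_star, star_mul, hs, ← (hc _).eq] using this
      | hadd a b ha hb => simp only [map_add, mul_add, ha, hb]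
      | hmul a b ha hb =>
        -- Centrality lets the projection move past the first factor to reach the second, and then
        -- back.
        rw [map_mul, map_mul, map_mul, ← mul_assoc, ha, mul_assoc, ← mul_assoc _ _ (_ : Au θ),
          (hc _).eq, mul_assoc, hb, ← mul_assoc, ← (hc _).eq, mul_assoc]
    have h2 : Au.toTorus hθ σ (UnivCStar.mk _ a) = UnivCStar.mk _ (eval g a) := by
      change Au.toTorus hθ σ (UnivCStar.mkHom _ a) = UnivCStar.mkHom _ (eval g a)
      clear h1
      induction a using FreeStarAlg.induct_X with
      | hc c => simp only [AlgHomClass.commutes]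
      | hX q =>
        refine (Au.toTorus_u hθ σ q.1 q.2).trans ?_
        rw [eval_X]
        simp only [g, torusU]
        split_ifs
        · rfl
        · rw [map_zero]
      | hstar a ha => simp only [map_star, ha]
      | hadd a b ha hb => simp only [map_add, ha, hb]
      | hmul a b ha hb => simp only [map_mul, ha, hb]
    rw [h1, h2, UnivCStar.norm_mk]
    exact RelSeminorm.le_univ (RelSeminorm.ofCorner (rel := TorusRel (twist θ σ))
      (fun i => Au.u θ i (σ⁻¹ i)) (Au.isStarProjection_mapProj hθ σ)
      (Au.mapProj_commute hθ σ) (Au.mapProj_mul_torusRel hθ σ)) (eval g a)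

theorem Au.toTorus_mapProj_self (hθ : ∀ i j, θ j i = -θ i j) (σ : Equiv.Perm (Fin n)) :
    Au.toTorus hθ σ (Au.mapProj hθ σ : Au θ) = 1 := by
  refine Finset.prod_induction (fun k => Au.proj hθ (σ k) k)
    (fun z => Au.toTorus hθ σ (z : Au θ) = 1) (fun a b ha hb => ?_) (map_one _) fun k _ => ?_
  · rw [Subring.coe_mul, map_mul, ha, hb, one_mul]
  · change Au.toTorus hθ σ (star (Au.u θ (σ k) k) * Au.u θ (σ k) k) = 1
    rw [map_mul, map_star, Au.toTorus_u, torusU, if_pos rfl, NCTorus.star_x_mul_x]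

/-- Where `σ` and `τ` differ, at `k` say, the factor `p_{τ(k),k}` is sent to zero. -/
theorem Au.toTorus_mapProj_of_ne (hθ : ∀ i j, θ j i = -θ i j) {σ τ : Equiv.Perm (Fin n)}
    (h : σ ≠ τ) : Au.toTorus hθ σ (Au.mapProj hθ τ : Au θ) = 0 := by
  obtain ⟨k, hk⟩ : ∃ k, σ k ≠ τ k := by
    by_contra! hk
    exact h (Equiv.ext hk)
  rw [← Au.mapProj_mul_proj hθ τ k, map_mul, map_mul, Au.toTorus_u, torusU, if_neg hk, mul_zero,
    mul_zero]

/-! ### The isomorphism with the multitorus -/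

/-- The `*`-homomorphism from `A_u` to the quantum multitorus. -/
def Au.toMultitorus (hθ : ∀ i j, θ j i = -θ i j) : Au θ →⋆ₐ[ℂ] Multitorus θ where
  toFun x σ := Au.toTorus hθ σ x
  map_one' := funext fun σ => map_one (Au.toTorus hθ σ)
  map_zero' := funext fun σ => map_zero (Au.toTorus hθ σ)
  map_mul' x y := funext fun σ => map_mul (Au.toTorus hθ σ) x y
  map_add' x y := funext fun σ => map_add (Au.toTorus hθ σ) x y
  commutes' c := funext fun σ => AlgHomClass.commutes (Au.toTorus hθ σ) c
  map_star' x := funext fun σ => map_star (Au.toTorus hθ σ) x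

theorem Au.toMultitorus_apply (hθ : ∀ i j, θ j i = -θ i j) (x : Au θ)
    (σ : Equiv.Perm (Fin n)) : Au.toMultitorus hθ x σ = Au.toTorus hθ σ x := rfl

theorem Au.toMultitorus_injective (hθ : ∀ i j, θ j i = -θ i j) :
    Function.Injective (Au.toMultitorus hθ) := by
  refine (injective_iff_map_eq_zero _).2 fun x hx => ?_
  have h1 : ∀ f : Fin n → Fin n, (Au.mapProj hθ f : Au θ) * x = 0 := fun f => by
    by_cases hf : Function.Injective f
    · have h := Au.norm_mapProj_mul_le hθ
        (Equiv.ofBijective f (Finite.injective_iff_bijective.1 hf)) x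
      rw [← Au.toMultitorus_apply, hx, Pi.zero_apply, norm_zero] at h
      exact norm_le_zero_iff.1 h
    · rw [Au.mapProj_eq_zero hθ hf, Subring.coe_zero, zero_mul]
  -- The decomposition of `1` runs over all functions, so the non-injective ones are included with
  -- zero contribution.
  have h2 : (((∑ f, Au.mapProj hθ f : Subring.center (Au θ)) : Au θ)) * x = 0 := by
    rw [AddSubmonoidClass.coe_finsetSum, Finset.sum_mul]
    exact Finset.sum_eq_zero fun f _ => h1 f
  rwa [Au.sum_mapProj, Subring.coe_one, one_mul] at h2

/-- The generator `x_i` lifts to `u_{i,σ⁻¹(i)}`. Polynomials are enough, since density is all that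
the surjectivity argument uses. -/
theorem Au.toTorus_surjective_mk (hθ : ∀ i j, θ j i = -θ i j) (σ : Equiv.Perm (Fin n))
    (a : FreeStarAlg (Fin n)) : ∃ x : Au θ, Au.toTorus hθ σ x = UnivCStar.mk _ a := by
  refine ⟨eval (fun i => Au.u θ i (σ⁻¹ i)) a, ?_⟩
  change _ = UnivCStar.mkHom _ a
  induction a using FreeStarAlg.induct_X with
  | hc c => simp only [AlgHomClass.commutes]
  | hX i =>
    rw [eval_X, Au.toTorus_u, torusU, if_pos (show σ (σ⁻¹ i) = i from σ.apply_symm_apply i)]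
    rfl
  | hstar a ha => simp only [map_star, ha]
  | hadd a b ha hb => simp only [map_add, ha, hb]
  | hmul a b ha hb => simp only [map_mul, ha, hb]

theorem Au.toMultitorus_mapProj_mul (hθ : ∀ i j, θ j i = -θ i j) (σ : Equiv.Perm (Fin n))
    (x : Au θ) : Au.toMultitorus hθ ((Au.mapProj hθ σ : Au θ) * x) =
      Pi.single σ (Au.toTorus hθ σ x) := by
  ext τ
  rw [Au.toMultitorus_apply, map_mul]
  by_cases h : τ = σ
  · subst h
    rw [Au.toTorus_mapProj_self, one_mul, Pi.single_eq_same]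
  · rw [Au.toTorus_mapProj_of_ne hθ h, zero_mul, Pi.single_eq_of_ne h]

theorem Au.toMultitorus_surjective (hθ : ∀ i j, θ j i = -θ i j) :
    Function.Surjective (Au.toMultitorus hθ) := by
  -- An injective `*`-homomorphism of C*-algebras is isometric, so its range is complete.
  have hcl : IsClosed (Set.range (Au.toMultitorus hθ)) :=
    (NonUnitalStarAlgHom.isometry (Au.toMultitorus hθ)
      (Au.toMultitorus_injective hθ)).isClosedEmbedding.isClosed_range
  have hs : ∀ σ (y : NCTorus (twist θ σ)),
      (Pi.single σ y : Multitorus θ) ∈ Set.range (Au.toMultitorus hθ) := fun σ y => by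
    induction y using UnivCStar.induct with
    | hp => exact hcl.preimage (continuous_single σ)
    | h a =>
      obtain ⟨x, hx⟩ := Au.toTorus_surjective_mk hθ σ a
      exact ⟨_, (Au.toMultitorus_mapProj_mul hθ σ x).trans (by rw [hx])⟩
  intro y
  choose x hx using fun σ => hs σ (y σ)
  exact ⟨∑ σ, x σ, by rw [map_sum, Finset.sum_congr rfl fun σ _ => hx σ, Finset.univ_sum_single]⟩

end Au

end QMultitorus

end

theorem mainTheorem2 (n : ℕ) (θ : Matrix (Fin n) (Fin n) ℝ) (hθ : ∀ i j, θ j i = -θ i j) :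
    ∃ Φ : QMultitorus.Au θ ≃⋆ₐ[ℂ] QMultitorus.Multitorus θ,
      ∀ i k : Fin n, Φ (QMultitorus.Au.u θ i k) =
        ∑ σ : Equiv.Perm (Fin n) with σ k = i, QMultitorus.Multitorus.x θ σ i := by
  refine ⟨StarAlgEquiv.ofBijective (QMultitorus.Au.toMultitorus hθ)
    ⟨QMultitorus.Au.toMultitorus_injective hθ, QMultitorus.Au.toMultitorus_surjective hθ⟩,
    fun i k => ?_⟩
  refine (StarAlgEquiv.ofBijective_apply _ _).trans ?_
  ext τ
  -- In component `τ` only the summand `σ = τ` contributes, and the filter condition `τ k = i` is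
  -- the case distinction in `torusU`.
  rw [QMultitorus.Au.toMultitorus_apply, QMultitorus.Au.toTorus_u, Finset.sum_apply,
    Finset.sum_filter, Finset.sum_eq_single τ]
  · simp [QMultitorus.torusU, QMultitorus.Multitorus.x]
  · intro σ _ h
    simp [QMultitorus.Multitorus.x, h.symm]
  · simp
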